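/- For an integer $k\ge 2$ let $G_k=\{0,1,\dots,k-1\}\times\{0,1,\dots,k-1\}$ be the vertex set of the $k\times k$ grid graph, in which two vertices are adjacent when they agree in one coordinate and differ by exactly $1$ in the other. For an arbitrary subset $\xi^k\subseteq G_k$, let $c(\xi^k)$ be the minimum, over all assignments of one of the two colors green and yellow to each vertex of $G_k$ for which each color is used on at least $k^2/4$ vertices, of the number of adjacent pairs consisting of one green and one yellow vertex, neither of which is in $\xi^k$. (Adjacent vertices may have the same color.) Then there exists $q\in(0,1]$, not depending on $k$, such that, taking $\Xi^k$ to be the random subset of $G_k$ in which each vertex is present independently with probability $q$, \[ \Pr\bigl(c(\Xi^k)<k/400\bigr)\to 0\quad\text{as } k\to\infty. \] -/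

import Mathlib

open MeasureTheory ProbabilityTheory Filter Topology
open scoped SimpleGraph

/-- The vertex set `{0, …, k-1} × {0, …, k-1}` of the `k × k` grid. -/
abbrev GridVertex (k : ℕ) : Type := Fin k × Fin k

/-- The `k × k` grid graph: two vertices are adjacent when they agree in one coordinate and
differ by exactly one in the other. -/
def gridGraph (k : ℕ) : SimpleGraph (GridVertex k) :=
  SimpleGraph.pathGraph k □ SimpleGraph.pathGraph k

/-- The two colors. -/
inductive GYColor : Type
  | green
  | yellow

/-- A green-yellow coloring (any assignment of colors to vertices) is admissible if each color
is used on at least `k ^ 2 / 4` vertices. -/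
def IsAdmissibleColoring (k : ℕ) (χ : GridVertex k → GYColor) : Prop :=
  ∀ a : GYColor, (k : ℝ) ^ 2 / 4 ≤ ({v | χ v = a}.ncard : ℝ)

/-- The number of adjacent green-yellow pairs with neither vertex in `ξ`. Each unordered pair is
counted once, being listed with its green vertex first. -/
noncomputable def greenYellowCount (k : ℕ) (ξ : Set (GridVertex k))
    (χ : GridVertex k → GYColor) : ℕ :=
  {p : GridVertex k × GridVertex k | (gridGraph k).Adj p.1 p.2 ∧
    χ p.1 = GYColor.green ∧ χ p.2 = GYColor.yellow ∧ p.1 ∉ ξ ∧ p.2 ∉ ξ}.ncard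

/-- The minimum `c(ξ)` of `greenYellowCount` over all admissible colorings. An infimum in `ℕ`
over a nonempty set is a minimum; admissible colorings exist for every `k ≠ 1`. -/
noncomputable def minGreenYellow (k : ℕ) (ξ : Set (GridVertex k)) : ℕ :=
  sInf {n | ∃ χ : GridVertex k → GYColor, IsAdmissibleColoring k χ ∧ greenYellowCount k ξ χ = n}

/-! ### Bernoulli random subsets of a finite set. -/

section BernoulliSubset

variable {V : Type*}

/-! Split the two-colored edges of a coloring into clusters, edges being linked when they are
`nearby`. The four edges of a unit square are mutually nearby, so each cluster `S` meets every
square evenly and is itself a cut; a cut of `n` edges separates at most `n ^ 2` vertices from the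
rest. Hence the sum of `|S| ^ 2` over the clusters bounds the size of one color class
(`card_ne_le_sum_clusters_sq`), and so is at least `k ^ 2 / 4`.

A cluster that is not bad keeps at least half its edges after the vertices of `ξ` are removed, so
such clusters contribute at most `(2 * greenYellowCount) ^ 2`. The bad ones contribute at most `X`,
the sum of `|S| ^ 2` over all bad clusters of the grid, which does not depend on the coloring. If
the minimum is below `k / 400`, then `X ≥ k ^ 2 / 8`.

For small `q`, badness is exponentially unlikely in `|S|`, while the number of clusters of a given
size through an edge grows only exponentially. This gives `E X ≤ k ^ 2 / 16` and `Var X ≤ k ^ 2`,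
since clusters without a common endpoint are uncorrelated. Chebyshev's inequality bounds the
probability by `256 / k ^ 2`. -/

theorem discreteMeasurableSpace_set [Finite V] : DiscreteMeasurableSpace (Set V) where
  forall_measurableSet s := by
    have : DiscreteMeasurableSpace (V → Prop) := inferInstance
    have h := (MeasurableEquiv.setOfPred (α := V)).symm.measurableEmbedding.measurable
      (MeasurableSet.of_discrete (s := (fun p : V → Prop => {i | p i}) ⁻¹' s))
    exact h

theorem setBernoulli_superset [Finite V] (q : unitInterval) (T : Finset V) :
    (setBernoulli (Set.univ : Set V) q).real {ξ | ↑T ⊆ ξ} = (q : ℝ) ^ T.card := by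
  have h : (fun p : V → Prop => {i | p i}) ⁻¹' {ξ : Set V | ↑T ⊆ ξ} =
      Set.pi T fun _ => {True} := by
    ext p; simp [Set.subset_def, Set.mem_pi]
  rw [measureReal_def, setBernoulli_apply', h, Measure.infinitePi_pi]
  · simp
  · intro i _
    exact MeasurableSet.of_discrete

theorem iIndepFun_mem_setBernoulli [Finite V] (q : unitInterval) :
    iIndepFun (fun (v : V) (ξ : Set V) => v ∈ ξ) (setBernoulli (Set.univ : Set V) q) := by
  have := discreteMeasurableSpace_set (V := V)
  rw [iIndepFun_iff_map_fun_eq_infinitePi_map (fun i => Measurable.of_discrete)]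
  rw [setBernoulli_eq_map, Measure.map_map Measurable.of_discrete Measurable.of_discrete]
  simp_rw [Measure.map_map (Measurable.of_discrete (f := fun ξ : Set V => _ ∈ ξ)) (Measurable.of_discrete (f := fun p : V → Prop => {i | p i}))]
  have h1 : ((fun (ξ : Set V) (i : V) => i ∈ ξ) ∘ fun p : V → Prop => {i | p i}) = id := rfl
  rw [h1, Measure.map_id]
  congr 1
  funext i
  exact (Measure.infinitePi_map_eval
    (fun _ : V => unitInterval.toNNReal q • Measure.dirac (_ ∈ (Set.univ : Set V)) +
      unitInterval.toNNReal (unitInterval.symm q) • Measure.dirac False) i).symm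

theorem indepFun_setBernoulli_of_disjoint [Finite V] (q : unitInterval) {S T : Finset V}
    (hST : Disjoint S T) {F G : Set V → ℝ} (hF : ∀ ξ, F (ξ ∩ S) = F ξ)
    (hG : ∀ ξ, G (ξ ∩ T) = G ξ) :
    IndepFun F G (setBernoulli (Set.univ : Set V) q) := by
  have := discreteMeasurableSpace_set (V := V)
  have h := (iIndepFun_mem_setBernoulli (V := V) q).indepFun_finset S T hST
    (fun _ => Measurable.of_discrete)
  -- A function that sees only `ξ ∩ U` factors through the coordinates in `U`.
  have hext (U : Finset V) (F : Set V → ℝ) (hF : ∀ ξ, F (ξ ∩ U) = F ξ) :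
      (fun g : U → Prop => F {v | ∃ h : v ∈ U, g ⟨v, h⟩}) ∘
        (fun (ξ : Set V) (i : U) => (i : V) ∈ ξ) = F := by
    funext ξ
    rw [← hF ξ]
    simp only [Function.comp]
    congr 1
    ext v
    simp [and_comm]
  have h2 := h.comp (φ := fun g : S → Prop => F {v | ∃ h : v ∈ S, g ⟨v, h⟩})
    (ψ := fun g : T → Prop => G {v | ∃ h : v ∈ T, g ⟨v, h⟩})
    Measurable.of_discrete Measurable.of_discrete
  rwa [hext S F hF, hext T G hG] at h2

theorem memLp_setBernoulli [Finite V] {q : unitInterval} {f : Set V → ℝ} {p : ENNReal} :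
    MemLp f p (setBernoulli (Set.univ : Set V) q) := by
  have := discreteMeasurableSpace_set (V := V)
  exact MemLp.of_discrete

end BernoulliSubset

/-! ### Counting clusters through a given element. -/

section Animals

variable {E : Type*} [DecidableEq E]

/-- `S` cannot be split into two nonempty parts with no neighbors in each other. -/
def IsClusterFor (nb : E → Finset E) (S : Finset E) : Prop :=
  ∀ A ⊆ S, A.Nonempty → A ≠ S → ∃ x ∈ A, ∃ y ∈ S \ A, y ∈ nb x

/-- The vertex sets of the walks of length `n` starting at `e`. -/
def walkRanges (nb : E → Finset E) : ℕ → E → Finset (Finset E)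
  | 0, e => {{e}}
  | n + 1, e => (nb e).biUnion fun y => (walkRanges nb n y).image (insert e)

theorem card_walkRanges_le {nb : E → Finset E} {Δ : ℕ} (hΔ : ∀ e, (nb e).card ≤ Δ) (n : ℕ)
    (e : E) : (walkRanges nb n e).card ≤ Δ ^ n := by
  induction n generalizing e with
  | zero => simp [walkRanges]
  | succ n ih =>
    calc (walkRanges nb (n + 1) e).card
        ≤ ∑ y ∈ nb e, ((walkRanges nb n y).image (insert e)).card := Finset.card_biUnion_le
      _ ≤ ∑ _y ∈ nb e, Δ ^ n :=
          Finset.sum_le_sum fun y _ => Finset.card_image_le.trans (ih y)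
      _ ≤ Δ ^ (n + 1) := by
          rw [Finset.sum_const, smul_eq_mul, pow_succ']
          exact Nat.mul_le_mul_right _ (hΔ e)

/-- When the walk visits `x`, insert the detour `x, y, x`, which costs two steps. -/
theorem insert_mem_walkRanges {nb : E → Finset E} (hsymm : ∀ x y, y ∈ nb x → x ∈ nb y)
    {n : ℕ} {e : E} {A : Finset E} (hA : A ∈ walkRanges nb n e) {x y : E} (hx : x ∈ A)
    (hy : y ∈ nb x) : insert y A ∈ walkRanges nb (n + 2) e := by
  have detour {n : ℕ} {e : E} {A : Finset E} (hA : A ∈ walkRanges nb n e) (heA : e ∈ A)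
      (hy : y ∈ nb e) : insert y A ∈ walkRanges nb (n + 2) e := by
    simp only [walkRanges, Finset.mem_biUnion, Finset.mem_image]
    refine ⟨y, hy, insert y A, ⟨e, hsymm _ _ hy, A, hA, rfl⟩, ?_⟩
    rw [Finset.insert_eq_of_mem (Finset.mem_insert_of_mem heA)]
  induction n generalizing e A with
  | zero =>
    have hAe : A = {e} := by simpa [walkRanges] using hA
    subst hAe
    obtain rfl := Finset.mem_singleton.1 hx
    exact detour hA (Finset.mem_singleton_self _) hy
  | succ n ih =>
    have hA' := hA
    simp only [walkRanges, Finset.mem_biUnion, Finset.mem_image] at hA'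
    obtain ⟨z, hz, B, hB, rfl⟩ := hA'
    rcases Finset.mem_insert.1 hx with rfl | hxB
    · exact detour hA (Finset.mem_insert_self _ _) hy
    · rw [Finset.insert_comm, walkRanges]
      exact Finset.mem_biUnion.2 ⟨z, hz, Finset.mem_image.2 ⟨_, ih hB hxB, rfl⟩⟩

/-- Grow a subset from `{e}` one neighbor at a time, each addition being a detour of length two. -/
theorem mem_walkRanges_of_isClusterFor {nb : E → Finset E}
    (hsymm : ∀ x y, y ∈ nb x → x ∈ nb y) {S : Finset E} (hS : IsClusterFor nb S) {e : E}
    (he : e ∈ S) {m : ℕ} (hm : S.card = m + 1) : S ∈ walkRanges nb (2 * m) e := by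
  have key (j : ℕ) (hj : j ≤ m) : ∃ A ⊆ S, A ∈ walkRanges nb (2 * j) e ∧ A.card = j + 1 := by
    induction j with
    | zero => exact ⟨{e}, by simpa using he, by simp [walkRanges], by simp⟩
    | succ j ih =>
      obtain ⟨A, hAS, hA, hcard⟩ := ih (by omega)
      obtain ⟨x, hx, y, hy, hxy⟩ := hS A hAS (Finset.card_pos.1 (by omega))
        (by rintro rfl; omega)
      rw [Finset.mem_sdiff] at hy
      exact ⟨insert y A, Finset.insert_subset hy.1 hAS, insert_mem_walkRanges hsymm hA hx hxy,
        by rw [Finset.card_insert_of_notMem hy.2, hcard]⟩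
  obtain ⟨A, hAS, hA, hcard⟩ := key m le_rfl
  rwa [← Finset.eq_of_subset_of_card_le hAS (by omega)]

/-- At most `Δ ^ (2 * m)` clusters of size `m + 1` contain `e`, so the sum is dominated by a
geometric series of ratio `Δ ^ 2 * t ≤ 1 / 2`. -/
theorem sum_pow_card_clusters_le {nb : E → Finset E} {Δ : ℕ} (hΔ : ∀ e, (nb e).card ≤ Δ)
    (hsymm : ∀ x y, y ∈ nb x → x ∈ nb y) {C : Finset (Finset E)}
    (hC : ∀ S ∈ C, IsClusterFor nb S) {t : ℝ} (ht : 0 ≤ t) (hΔt : (Δ : ℝ) ^ 2 * t ≤ 1 / 2)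
    (e : E) : ∑ S ∈ C with e ∈ S, t ^ S.card ≤ 2 * t := by
  classical
  set N := C.sup Finset.card
  have hmaps : ∀ S ∈ C.filter (e ∈ ·), S.card - 1 ∈ Finset.range N := by
    intro S hS
    rw [Finset.mem_filter] at hS
    have h1 : S.card ≤ N := Finset.le_sup (f := Finset.card) hS.1
    have h2 := Finset.card_pos.2 ⟨e, hS.2⟩
    rw [Finset.mem_range]; omega
  rw [← Finset.sum_fiberwise_of_maps_to hmaps]
  have hfib (m : ℕ) : ∑ S ∈ C.filter (e ∈ ·) with S.card - 1 = m, t ^ S.card ≤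
      t * (1 / 2) ^ m := by
    have hmem : ∀ S ∈ (C.filter (e ∈ ·)).filter (fun S => S.card - 1 = m),
        S.card = m + 1 ∧ S ∈ walkRanges nb (2 * m) e := by
      intro S hS
      simp only [Finset.mem_filter] at hS
      have h2 := Finset.card_pos.2 ⟨e, hS.1.2⟩
      have h3 : S.card = m + 1 := by omega
      exact ⟨h3, mem_walkRanges_of_isClusterFor hsymm (hC S hS.1.1) hS.1.2 h3⟩
    rw [Finset.sum_congr rfl fun S hS => by rw [(hmem S hS).1], Finset.sum_const, nsmul_eq_mul]
    have hcard : (((C.filter (e ∈ ·)).filter (fun S => S.card - 1 = m)).card : ℝ) ≤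
        ((Δ : ℝ) ^ 2) ^ m := by
      have := (Finset.card_le_card fun S hS => (hmem S hS).2).trans
        (card_walkRanges_le hΔ (2 * m) e)
      rw [← pow_mul]
      exact_mod_cast this
    calc _ ≤ ((Δ : ℝ) ^ 2) ^ m * t ^ (m + 1) := by gcongr
      _ = t * ((Δ : ℝ) ^ 2 * t) ^ m := by ring
      _ ≤ t * (1 / 2) ^ m := by gcongr
  calc _ ≤ ∑ m ∈ Finset.range N, t * (1 / 2 : ℝ) ^ m := Finset.sum_le_sum fun m _ => hfib m
    _ = t * ∑ m ∈ Finset.range N, (1 / 2 : ℝ) ^ m := by rw [Finset.mul_sum]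
    _ ≤ t * 2 := by gcongr; exact sum_geometric_two_le N
    _ = 2 * t := mul_comm _ _

end Animals

theorem sum_le_sum_incident {E : Type*} [DecidableEq E] {C : Finset (Finset E)} {U : Finset E}
    (hU : ∀ S ∈ C, ∃ e ∈ U, e ∈ S) {f : Finset E → ℝ} (hf : ∀ S, 0 ≤ f S) :
    ∑ S ∈ C, f S ≤ ∑ e ∈ U, ∑ S ∈ C with e ∈ S, f S := by
  simp_rw [Finset.sum_filter]
  rw [Finset.sum_comm]
  refine Finset.sum_le_sum fun S hS => ?_
  obtain ⟨e, heU, heS⟩ := hU S hS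
  calc f S = if e ∈ S then f S else 0 := by rw [if_pos heS]
    _ ≤ _ := Finset.single_le_sum (f := fun e => if e ∈ S then f S else 0)
        (fun e _ => by split_ifs <;> simp [hf]) heU

theorem natCast_sq_le_four_pow (n : ℕ) : (n : ℝ) ^ 2 ≤ 4 ^ n := by
  have h : (n : ℝ) ≤ 2 ^ n := by exact_mod_cast Nat.lt_two_pow_self.le
  calc (n : ℝ) ^ 2 ≤ (2 ^ n) ^ 2 := by gcongr
    _ = 4 ^ n := by rw [← pow_mul, mul_comm, pow_mul]; norm_num

/-! ### Mean and variance of the total weight of bad clusters. -/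

section BadClusters

variable {V E : Type*} [DecidableEq V]

/-- The edge set `S`, where the edge `e` has the endpoints `ends e`, is `κ`-bad if `ξ` contains
at least `|S| / κ` of its endpoints. -/
def IsBadFor (ends : E → Finset V) (κ : ℕ) (ξ : Set V) (S : Finset E) : Prop :=
  (S.card : ℝ) ≤ κ * ((↑(S.biUnion ends) ∩ ξ).ncard : ℝ)

open Classical in
/-- The contribution `|S| ^ 2` of a bad edge set `S`. -/
noncomputable def badWeight (ends : E → Finset V) (κ : ℕ) (S : Finset E) (ξ : Set V) : ℝ :=
  if IsBadFor ends κ ξ S then (S.card : ℝ) ^ 2 else 0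

theorem badWeight_nonneg (ends : E → Finset V) (κ : ℕ) (S : Finset E) (ξ : Set V) :
    0 ≤ badWeight ends κ S ξ := by
  unfold badWeight; split_ifs <;> positivity

theorem badWeight_inter (ends : E → Finset V) (κ : ℕ) (S : Finset E) (ξ : Set V) :
    badWeight ends κ S (ξ ∩ ↑(S.biUnion ends)) = badWeight ends κ S ξ := by
  have h : (↑(S.biUnion ends) ∩ (ξ ∩ ↑(S.biUnion ends)) : Set V) =
      ↑(S.biUnion ends) ∩ ξ := by
    ext v; simp only [Set.mem_inter_iff]; tauto
  have h' : IsBadFor ends κ (ξ ∩ ↑(S.biUnion ends)) S ↔ IsBadFor ends κ ξ S := by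
    rw [IsBadFor, IsBadFor, h]
  by_cases hb : IsBadFor ends κ ξ S
  · simp only [badWeight, if_pos (h'.2 hb), if_pos hb]
  · simp only [badWeight, if_neg (mt h'.1 hb), if_neg hb]

variable [Fintype V]

/-- Union bound over the at most `2 ^ (2 * |S|)` sets `T` of endpoints with `|S| ≤ κ * |T|`; each
lies in `ξ` with probability `s ^ (2 * κ * |T|) ≤ s ^ (2 * |S|)`. The outer square is spent in the
covariance bound. -/
theorem setBernoulli_isBadFor_le {ends : E → Finset V} (hends : ∀ e, (ends e).card ≤ 2) {κ : ℕ}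
    {q : unitInterval} {s : ℝ} (hs0 : 0 ≤ s) (hs1 : s ≤ 1) (hq : (q : ℝ) = s ^ (2 * κ))
    (S : Finset E) :
    (setBernoulli (Set.univ : Set V) q).real {ξ | IsBadFor ends κ ξ S} ≤
      ((2 * s) ^ S.card) ^ 2 := by
  classical
  set W := S.biUnion ends
  have hW : W.card ≤ 2 * S.card := by
    refine Finset.card_biUnion_le.trans ?_
    calc ∑ e ∈ S, (ends e).card ≤ ∑ _e ∈ S, 2 := Finset.sum_le_sum fun e _ => hends e
      _ = 2 * S.card := by simp [mul_comm]
  set F := W.powerset.filter fun T => S.card ≤ κ * T.card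
  have hsub : {ξ | IsBadFor ends κ ξ S} ⊆ ⋃ T ∈ F, {ξ : Set V | ↑T ⊆ ξ} := by
    intro ξ hξ
    have hξ' : (S.card : ℝ) ≤ κ * ((↑W ∩ ξ).ncard : ℝ) := hξ
    have hT : (↑(W.filter (· ∈ ξ)) : Set V) = ↑W ∩ ξ := by ext v; simp
    rw [← hT, Set.ncard_coe_finset] at hξ'
    simp only [Set.mem_iUnion]
    refine ⟨W.filter (· ∈ ξ), ?_, fun v hv => by simpa using (Finset.mem_filter.1 hv).2⟩
    simp only [F, Finset.mem_filter, Finset.mem_powerset]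
    exact ⟨Finset.filter_subset _ _, by exact_mod_cast hξ'⟩
  calc _ ≤ (setBernoulli (Set.univ : Set V) q).real (⋃ T ∈ F, {ξ : Set V | ↑T ⊆ ξ}) :=
        measureReal_mono hsub (measure_ne_top _ _)
    _ ≤ ∑ T ∈ F, (setBernoulli (Set.univ : Set V) q).real {ξ : Set V | ↑T ⊆ ξ} :=
        measureReal_biUnion_finset_le _ _
    _ ≤ ∑ _T ∈ F, s ^ (2 * S.card) := by
        refine Finset.sum_le_sum fun T hT => ?_
        rw [setBernoulli_superset, hq, ← pow_mul]
        refine pow_le_pow_of_le_one hs0 hs1 ?_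
        have := (Finset.mem_filter.1 hT).2
        rw [mul_assoc]; omega
    _ = F.card * s ^ (2 * S.card) := by rw [Finset.sum_const, nsmul_eq_mul]
    _ ≤ 2 ^ (2 * S.card) * s ^ (2 * S.card) := by
        gcongr
        have : F.card ≤ 2 ^ W.card := by
          rw [← Finset.card_powerset]; exact Finset.card_filter_le _ _
        exact_mod_cast this.trans (Nat.pow_le_pow_right (by norm_num) hW)
    _ = ((2 * s) ^ S.card) ^ 2 := by rw [← mul_pow, mul_comm 2 S.card, pow_mul]

variable {ends : E → Finset V} {κ : ℕ} {q : unitInterval} {s : ℝ}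

theorem integral_badWeight_le (hends : ∀ e, (ends e).card ≤ 2)
    (hs0 : 0 ≤ s) (hs1 : 2 * s ≤ 1) (hq : (q : ℝ) = s ^ (2 * κ)) (S : Finset E) :
    ∫ ξ, badWeight ends κ S ξ ∂setBernoulli (Set.univ : Set V) q ≤ (8 * s) ^ S.card := by
  classical
  have := discreteMeasurableSpace_set (V := V)
  have h : badWeight ends κ S =
      Set.indicator {ξ | IsBadFor ends κ ξ S} fun _ => (S.card : ℝ) ^ 2 := by
    funext ξ; simp [badWeight, Set.indicator]
  rw [h, integral_indicator_const _ MeasurableSet.of_discrete, smul_eq_mul]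
  have h1 : (2 * s) ^ S.card ≤ 1 := pow_le_one₀ (by positivity) hs1
  calc _ ≤ ((2 * s) ^ S.card) ^ 2 * (4 : ℝ) ^ S.card := by
        gcongr
        · exact setBernoulli_isBadFor_le hends hs0 (by linarith) hq S
        · exact natCast_sq_le_four_pow _
    _ ≤ (2 * s) ^ S.card * (4 : ℝ) ^ S.card := by
        gcongr
        exact pow_le_of_le_one (by positivity) h1 two_ne_zero
    _ = (8 * s) ^ S.card := by rw [← mul_pow]; ring

/-- No independence is needed: the probability that both are bad is at most the geometric mean of
the two probabilities, which still decays in both sizes. -/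
theorem covariance_badWeight_le (hends : ∀ e, (ends e).card ≤ 2)
    (hs0 : 0 ≤ s) (hs1 : s ≤ 1) (hq : (q : ℝ) = s ^ (2 * κ)) (S T : Finset E) :
    cov[badWeight ends κ S, badWeight ends κ T; setBernoulli (Set.univ : Set V) q] ≤
      (8 * s) ^ S.card * (8 * s) ^ T.card := by
  classical
  have := discreteMeasurableSpace_set (V := V)
  set μ := setBernoulli (Set.univ : Set V) q
  rw [covariance_eq_sub memLp_setBernoulli memLp_setBernoulli]
  have h0 : 0 ≤ μ[badWeight ends κ S] * μ[badWeight ends κ T] :=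
    mul_nonneg (integral_nonneg fun ξ => badWeight_nonneg _ _ _ _)
      (integral_nonneg fun ξ => badWeight_nonneg _ _ _ _)
  have h : badWeight ends κ S * badWeight ends κ T =
      Set.indicator ({ξ | IsBadFor ends κ ξ S} ∩ {ξ | IsBadFor ends κ ξ T})
        fun _ => (S.card : ℝ) ^ 2 * (T.card : ℝ) ^ 2 := by
    funext ξ
    by_cases h1 : IsBadFor ends κ ξ S <;> by_cases h2 : IsBadFor ends κ ξ T <;>
      simp [badWeight, Set.indicator, h1, h2]
  rw [h, integral_indicator_const _ MeasurableSet.of_discrete, smul_eq_mul]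
  set p := μ.real ({ξ | IsBadFor ends κ ξ S} ∩ {ξ | IsBadFor ends κ ξ T})
  have hp : p ≤ (2 * s) ^ S.card * (2 * s) ^ T.card := by
    have hS : p ≤ ((2 * s) ^ S.card) ^ 2 := (measureReal_mono Set.inter_subset_left).trans
      (setBernoulli_isBadFor_le hends hs0 hs1 hq S)
    have hT : p ≤ ((2 * s) ^ T.card) ^ 2 := (measureReal_mono Set.inter_subset_right).trans
      (setBernoulli_isBadFor_le hends hs0 hs1 hq T)
    have hp0 : 0 ≤ p := measureReal_nonneg
    refine abs_le_of_sq_le_sq' ?_ (by positivity) |>.2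
    calc p ^ 2 = p * p := sq p
      _ ≤ ((2 * s) ^ S.card) ^ 2 * ((2 * s) ^ T.card) ^ 2 := by gcongr
      _ = _ := by ring
  calc _ ≤ p * ((S.card : ℝ) ^ 2 * (T.card : ℝ) ^ 2) := by linarith
    _ ≤ (2 * s) ^ S.card * (2 * s) ^ T.card * (4 ^ S.card * 4 ^ T.card) := by
        gcongr <;> exact natCast_sq_le_four_pow _
    _ = ((2 * s) ^ S.card * 4 ^ S.card) * ((2 * s) ^ T.card * 4 ^ T.card) := by ring
    _ = _ := by rw [← mul_pow, ← mul_pow]; ring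

theorem covariance_badWeight_of_disjoint {S T : Finset E}
    (h : Disjoint (S.biUnion ends) (T.biUnion ends)) :
    cov[badWeight ends κ S, badWeight ends κ T; setBernoulli (Set.univ : Set V) q] = 0 :=
  (indepFun_setBernoulli_of_disjoint q h (badWeight_inter ends κ S)
    (badWeight_inter ends κ T)).covariance_eq_zero memLp_setBernoulli memLp_setBernoulli

variable [DecidableEq E] {nb : E → Finset E} {Δ : ℕ} {C : Finset (Finset E)} {B : Finset E}

theorem integral_sum_badWeight_le (hends : ∀ e, (ends e).card ≤ 2)
    (hs0 : 0 ≤ s) (hs1 : 2 * s ≤ 1) (hq : (q : ℝ) = s ^ (2 * κ))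
    (hΔ : ∀ e, (nb e).card ≤ Δ) (hsymm : ∀ x y, y ∈ nb x → x ∈ nb y)
    (hC : ∀ S ∈ C, IsClusterFor nb S) (hCB : ∀ S ∈ C, S ⊆ B) (hne : ∀ S ∈ C, S.Nonempty)
    (hΔs : (Δ : ℝ) ^ 2 * (8 * s) ≤ 1 / 2) :
    ∫ ξ, ∑ S ∈ C, badWeight ends κ S ξ ∂setBernoulli (Set.univ : Set V) q ≤
      16 * s * B.card := by
  rw [integral_finsetSum _ fun S _ =>
    memLp_one_iff_integrable.1 (memLp_setBernoulli (f := badWeight ends κ S))]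
  calc _ ≤ ∑ S ∈ C, (8 * s) ^ S.card :=
        Finset.sum_le_sum fun S _ => integral_badWeight_le hends hs0 hs1 hq S
    _ ≤ ∑ e ∈ B, ∑ S ∈ C with e ∈ S, (8 * s) ^ S.card :=
        sum_le_sum_incident (fun S hS => (hne S hS).imp fun e he => ⟨hCB S hS he, he⟩)
          fun S => by positivity
    _ ≤ ∑ _e ∈ B, 2 * (8 * s) := Finset.sum_le_sum fun e _ =>
        sum_pow_card_clusters_le hΔ hsymm hC (by positivity) hΔs e
    _ = _ := by rw [Finset.sum_const, nsmul_eq_mul]; ring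

theorem variance_sum_badWeight_le (hends : ∀ e, (ends e).card ≤ 2)
    (hs0 : 0 ≤ s) (hs1 : 2 * s ≤ 1) (hq : (q : ℝ) = s ^ (2 * κ))
    (hΔ : ∀ e, (nb e).card ≤ Δ) (hsymm : ∀ x y, y ∈ nb x → x ∈ nb y)
    (hnb : ∀ v x y, v ∈ ends x → v ∈ ends y → y ∈ nb x)
    (hC : ∀ S ∈ C, IsClusterFor nb S) (hCB : ∀ S ∈ C, S ⊆ B) (hne : ∀ S ∈ C, S.Nonempty)
    (hΔs : (Δ : ℝ) ^ 2 * (16 * s) ≤ 1 / 2) :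
    Var[fun ξ => ∑ S ∈ C, badWeight ends κ S ξ; setBernoulli (Set.univ : Set V) q] ≤
      512 * s ^ 2 * Δ * B.card := by
  classical
  rw [variance_fun_sum' fun S _ => memLp_setBernoulli]
  have hΔs' : (Δ : ℝ) ^ 2 * (8 * s) ≤ 1 / 2 := by
    have : 0 ≤ (Δ : ℝ) ^ 2 * (8 * s) := by positivity
    linarith
  have hinner (S : Finset E) : ∑ T ∈ C, cov[badWeight ends κ S, badWeight ends κ T;
      setBernoulli (Set.univ : Set V) q] ≤ (16 * s) ^ S.card * (16 * s * Δ) := by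
    -- A cluster sharing an endpoint with `S` contains an element of `U`, so only clusters through
    -- `U` can have nonzero covariance with `S`.
    set U := S.biUnion nb
    have hU : U.card ≤ S.card * Δ := Finset.card_biUnion_le_card_mul _ _ _ fun e _ => hΔ e
    have hmeet (T : Finset E) (hT : ¬ Disjoint (S.biUnion ends) (T.biUnion ends)) :
        ∃ e ∈ U, e ∈ T := by
      obtain ⟨v, hvS, hvT⟩ := Finset.not_disjoint_iff.1 hT
      obtain ⟨x, hx, hvx⟩ := Finset.mem_biUnion.1 hvS
      obtain ⟨y, hy, hvy⟩ := Finset.mem_biUnion.1 hvT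
      exact ⟨y, Finset.mem_biUnion.2 ⟨x, hx, hnb v x y hvx hvy⟩, hy⟩
    calc _ ≤ ∑ T ∈ C, if ¬ Disjoint (S.biUnion ends) (T.biUnion ends) then
          (8 * s) ^ S.card * (8 * s) ^ T.card else 0 := by
          refine Finset.sum_le_sum fun T _ => ?_
          rw [ite_not]
          split_ifs with h
          · exact (covariance_badWeight_of_disjoint h).le
          · exact covariance_badWeight_le hends hs0 (by linarith) hq S T
      _ = (8 * s) ^ S.card *
          ∑ T ∈ C.filter fun T => ¬ Disjoint (S.biUnion ends) (T.biUnion ends),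
            (8 * s) ^ T.card := by rw [← Finset.sum_filter, Finset.mul_sum]
      _ ≤ (8 * s) ^ S.card * ∑ e ∈ U,
          ∑ T ∈ (C.filter fun T => ¬ Disjoint (S.biUnion ends) (T.biUnion ends)) with e ∈ T,
            (8 * s) ^ T.card := by
          gcongr
          exact sum_le_sum_incident (fun T hT => hmeet T (Finset.mem_filter.1 hT).2)
            fun T => by positivity
      _ ≤ (8 * s) ^ S.card * ∑ _e ∈ U, 2 * (8 * s) := by
          gcongr with e
          exact sum_pow_card_clusters_le hΔ hsymm
            (fun T hT => hC T (Finset.mem_filter.1 hT).1) (by positivity) hΔs' e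
      _ = (8 * s) ^ S.card * (U.card * (16 * s)) := by
          rw [Finset.sum_const, nsmul_eq_mul]; ring
      -- The factor `|S|` from `|U| ≤ |S| * Δ` is absorbed by passing from `8 * s` to `16 * s`.
      _ ≤ (8 * s) ^ S.card * (2 ^ S.card * Δ * (16 * s)) := by
          gcongr
          have : U.card ≤ 2 ^ S.card * Δ :=
            hU.trans (Nat.mul_le_mul_right _ Nat.lt_two_pow_self.le)
          exact_mod_cast this
      _ = ((8 * s) ^ S.card * 2 ^ S.card) * (16 * s * Δ) := by ring
      _ = _ := by rw [← mul_pow]; ring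
  calc _ ≤ ∑ S ∈ C, (16 * s) ^ S.card * (16 * s * Δ) :=
        Finset.sum_le_sum fun S _ => hinner S
    _ = (∑ S ∈ C, (16 * s) ^ S.card) * (16 * s * Δ) := by rw [Finset.sum_mul]
    _ ≤ (∑ e ∈ B, ∑ S ∈ C with e ∈ S, (16 * s) ^ S.card) * (16 * s * Δ) := by
        gcongr
        exact sum_le_sum_incident (fun S hS => (hne S hS).imp fun e he => ⟨hCB S hS he, he⟩)
          fun S => by positivity
    _ ≤ (∑ _e ∈ B, 2 * (16 * s)) * (16 * s * Δ) := by
        gcongr with e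
        exact sum_pow_card_clusters_le hΔ hsymm hC (by positivity) hΔs e
    _ = _ := by rw [Finset.sum_const, nsmul_eq_mul]; ring

end BadClusters

/-! ### Decomposition of a finite set into maximal clusters. -/

section Clusters

variable {E : Type*} {nb : E → Finset E}

open Classical in
/-- The elements of `D` that can be reached from `e` by steps to neighbors in `D`. -/
noncomputable def clusterOf (nb : E → Finset E) (D : Finset E) (e : E) : Finset E :=
  D.filter fun y => Relation.ReflTransGen (fun a b => a ∈ D ∧ b ∈ D ∧ b ∈ nb a) e y

theorem mem_clusterOf {D : Finset E} {e y : E} : y ∈ clusterOf nb D e ↔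
    y ∈ D ∧ Relation.ReflTransGen (fun a b => a ∈ D ∧ b ∈ D ∧ b ∈ nb a) e y := by
  classical
  exact Finset.mem_filter

theorem clusterOf_eq_of_mem (hsymm : ∀ x y, y ∈ nb x → x ∈ nb y) {D : Finset E} {e y : E}
    (hy : y ∈ clusterOf nb D e) : clusterOf nb D y = clusterOf nb D e := by
  have hey := (mem_clusterOf.1 hy).2
  have hye : Relation.ReflTransGen (fun a b => a ∈ D ∧ b ∈ D ∧ b ∈ nb a) y e :=
    have : Std.Symm fun a b => a ∈ D ∧ b ∈ D ∧ b ∈ nb a :=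
      ⟨fun a b h => ⟨h.2.1, h.1, hsymm _ _ h.2.2⟩⟩
    Relation.ReflTransGen.stdSymm.symm _ _ hey
  ext z
  rw [mem_clusterOf, mem_clusterOf]
  exact and_congr_right fun _ => ⟨hey.trans, hye.trans⟩

variable [DecidableEq E]

/-- The decomposition of `D` into maximal clusters. -/
noncomputable def clusters (nb : E → Finset E) (D : Finset E) : Finset (Finset E) :=
  D.image (clusterOf nb D)

theorem mem_iff_clusterOf_eq (hsymm : ∀ x y, y ∈ nb x → x ∈ nb y) {D S : Finset E}
    (hS : S ∈ clusters nb D) {x : E} (hx : x ∈ D) : x ∈ S ↔ clusterOf nb D x = S := by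
  obtain ⟨e, -, rfl⟩ := Finset.mem_image.1 hS
  refine ⟨clusterOf_eq_of_mem hsymm, fun h => ?_⟩
  rw [← h, mem_clusterOf]
  exact ⟨hx, .refl⟩

theorem subset_of_mem_clusters {D S : Finset E} (hS : S ∈ clusters nb D) : S ⊆ D := by
  obtain ⟨e, -, rfl⟩ := Finset.mem_image.1 hS
  exact fun x hx => (mem_clusterOf.1 hx).1

theorem nonempty_of_mem_clusters {D S : Finset E} (hS : S ∈ clusters nb D) : S.Nonempty := by
  obtain ⟨e, he, rfl⟩ := Finset.mem_image.1 hS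
  exact ⟨e, mem_clusterOf.2 ⟨he, .refl⟩⟩

theorem mem_of_mem_clusters {D S : Finset E} (hS : S ∈ clusters nb D) {x y : E} (hx : x ∈ S)
    (hy : y ∈ D) (hxy : y ∈ nb x) : y ∈ S := by
  obtain ⟨e, -, rfl⟩ := Finset.mem_image.1 hS
  rw [mem_clusterOf] at hx ⊢
  exact ⟨hy, hx.2.tail ⟨hx.1, hy, hxy⟩⟩

theorem isClusterFor_of_mem_clusters (hsymm : ∀ x y, y ∈ nb x → x ∈ nb y) {D S : Finset E}
    (hS : S ∈ clusters nb D) : IsClusterFor nb S := by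
  intro A hAS ⟨a, ha⟩ hne
  by_contra! hcon
  refine hne (Finset.Subset.antisymm hAS fun y hy => ?_)
  rw [← (mem_iff_clusterOf_eq hsymm hS (subset_of_mem_clusters hS (hAS ha))).1 (hAS ha),
    mem_clusterOf] at hy
  have hreach := hy.2
  induction hreach with
  | refl => exact ha
  | @tail b c _ hbc ih =>
    have hb : b ∈ A := ih ⟨hbc.1, ‹_›⟩
    by_contra hc
    exact hcon b hb c (Finset.mem_sdiff.2
      ⟨mem_of_mem_clusters hS (hAS hb) hbc.2.1 hbc.2.2, hc⟩) hbc.2.2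

theorem sum_clusters {M : Type*} [AddCommMonoid M] (hsymm : ∀ x y, y ∈ nb x → x ∈ nb y)
    (D : Finset E) (φ : E → M) : ∑ S ∈ clusters nb D, ∑ e ∈ S, φ e = ∑ e ∈ D, φ e := by
  classical
  rw [← Finset.sum_fiberwise_of_maps_to (s := D) (t := clusters nb D) (g := clusterOf nb D)
    fun e he => Finset.mem_image_of_mem _ he]
  refine Finset.sum_congr rfl fun S hS => Finset.sum_congr ?_ fun _ _ => rfl
  ext x
  rw [Finset.mem_filter]
  exact ⟨fun hx => ⟨subset_of_mem_clusters hS hx,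
    (mem_iff_clusterOf_eq hsymm hS (subset_of_mem_clusters hS hx)).1 hx⟩,
    fun hx => (mem_iff_clusterOf_eq hsymm hS hx.1).2 hx.2⟩

end Clusters

/-! ### Cuts of the grid as mod 2 coboundaries. -/

section GridCuts

/-- The edge `(x, y, false)` joins `(x, y)` to `(x + 1, y)`, and the edge `(x, y, true)` joins
`(x, y)` to `(x, y + 1)`. -/
abbrev GridEdge : Type := ℕ × ℕ × Bool

/-- The left or lower endpoint of an edge. -/
def GridEdge.source (e : GridEdge) : ℕ × ℕ := (e.1, e.2.1)

/-- The right or upper endpoint of an edge. -/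
def GridEdge.target : GridEdge → ℕ × ℕ
  | (x, y, false) => (x + 1, y)
  | (x, y, true) => (x, y + 1)

/-- The edges whose coordinates differ by at most one from those of `e`. -/
def GridEdge.nearby (e : GridEdge) : Finset GridEdge :=
  Finset.Icc (e.1 - 1) (e.1 + 1) ×ˢ Finset.Icc (e.2.1 - 1) (e.2.1 + 1) ×ˢ Finset.univ

/-- The edges of the `k × k` grid. -/
def gridEdges (k : ℕ) : Finset GridEdge :=
  (Finset.range k ×ˢ Finset.range k ×ˢ Finset.univ).filter
    fun e => e.target.1 < k ∧ e.target.2 < k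

/-- The vertices of the `k × k` grid. -/
def gridBox (k : ℕ) : Finset (ℕ × ℕ) := Finset.range k ×ˢ Finset.range k

/-- The edges of the `k × k` grid at whose endpoints `g` takes different values. -/
def gridCut (k : ℕ) (g : ℕ × ℕ → ZMod 2) : Finset GridEdge :=
  (gridEdges k).filter fun e => g e.source ≠ g e.target

theorem mem_gridEdges_false {k x y : ℕ} :
    ((x, y, false) : GridEdge) ∈ gridEdges k ↔ x + 1 < k ∧ y < k := by
  rw [gridEdges, Finset.mem_filter]
  simp only [GridEdge.target, Finset.mem_product, Finset.mem_range, Finset.mem_univ, and_true]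
  omega

theorem mem_gridEdges_true {k x y : ℕ} :
    ((x, y, true) : GridEdge) ∈ gridEdges k ↔ x < k ∧ y + 1 < k := by
  rw [gridEdges, Finset.mem_filter]
  simp only [GridEdge.target, Finset.mem_product, Finset.mem_range, Finset.mem_univ, and_true]
  omega

theorem card_gridEdges_le (k : ℕ) : (gridEdges k).card ≤ 2 * k ^ 2 := by
  refine (Finset.card_filter_le _ _).trans ?_
  simp only [Finset.card_product, Finset.card_range, Finset.card_univ, Fintype.card_bool]
  apply le_of_eq; ring

theorem GridEdge.mem_nearby {e f : GridEdge} : f ∈ e.nearby ↔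
    (e.1 - 1 ≤ f.1 ∧ f.1 ≤ e.1 + 1) ∧ e.2.1 - 1 ≤ f.2.1 ∧ f.2.1 ≤ e.2.1 + 1 := by
  simp only [nearby, Finset.mem_product, Finset.mem_Icc, Finset.mem_univ, and_true]

theorem GridEdge.nearby_symm (e f : GridEdge) (h : f ∈ e.nearby) : e ∈ f.nearby := by
  rw [mem_nearby] at *; omega

theorem GridEdge.card_nearby_le (e : GridEdge) : e.nearby.card ≤ 18 := by
  simp only [nearby, Finset.card_product, Nat.card_Icc, Finset.card_univ, Fintype.card_bool]
  have h1 : e.1 + 1 + 1 - (e.1 - 1) ≤ 3 := by omega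
  have h2 : e.2.1 + 1 + 1 - (e.2.1 - 1) ≤ 3 := by omega
  calc _ ≤ 3 * (3 * 2) := by gcongr
    _ = 18 := rfl

/-- Discrete Poincaré lemma: integrate `F` along the bottom row and then up the column. Vertical
edges are then automatic; horizontal ones follow by induction on the height, one square at a time.
-/
theorem exists_potential {k : ℕ} (F : GridEdge → ZMod 2)
    (hF : ∀ x y, x + 1 < k → y + 1 < k →
      F (x, y, false) + F (x + 1, y, true) + F (x, y + 1, false) + F (x, y, true) = 0) :
    ∃ g : ℕ × ℕ → ZMod 2, ∀ e ∈ gridEdges k, g e.target = g e.source + F e := by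
  refine ⟨fun v => ∑ i ∈ Finset.range v.1, F (i, 0, false) +
    ∑ j ∈ Finset.range v.2, F (v.1, j, true), ?_⟩
  rintro ⟨x, y, b⟩ he
  cases b with
  | true =>
    simp only [GridEdge.target, GridEdge.source, Finset.sum_range_succ]
    ring
  | false =>
    rw [mem_gridEdges_false] at he
    simp only [GridEdge.target, GridEdge.source, Finset.sum_range_succ]
    obtain ⟨hx, hy⟩ := he
    induction y with
    | zero => simp
    | succ y ih =>
      have h := hF x y hx hy
      have ih := ih (by omega)
      simp only [Finset.sum_range_succ]
      have h2 : ∀ a : ZMod 2, a + a = 0 := CharTwo.add_self_eq_zero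
      linear_combination ih + h - h2 (F (x, y + 1, false)) - h2 (F (x, y, true))

/-- `g` is constant on rows outside `R` and on columns outside `L`. If the cut has fewer than `k`
edges, there is such a row and such a column, and every vertex outside `L ×ˢ R` is joined to their
crossing along lines of constancy. -/
theorem card_ne_le_card_gridCut_sq {k : ℕ} (g : ℕ × ℕ → ZMod 2) :
    ∃ c, ((gridBox k).filter fun v => g v ≠ c).card ≤ (gridCut k g).card ^ 2 := by
  set D := gridCut k g
  set R := D.image fun e => e.2.1
  set L := D.image fun e => e.1
  have hR : R.card ≤ D.card := Finset.card_image_le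
  have hL : L.card ≤ D.card := Finset.card_image_le
  have hrow (y : ℕ) (hy : y < k) (hyR : y ∉ R) (x : ℕ) (hx : x < k) : g (x, y) = g (0, y) := by
    induction x with
    | zero => rfl
    | succ x ih =>
      rw [← ih (by omega)]
      by_contra hne
      refine hyR (Finset.mem_image.2 ⟨(x, y, false), ?_, rfl⟩)
      exact Finset.mem_filter.2 ⟨mem_gridEdges_false.2 ⟨hx, hy⟩, fun h => hne h.symm⟩
  have hcol (x : ℕ) (hx : x < k) (hxL : x ∉ L) (y : ℕ) (hy : y < k) : g (x, y) = g (x, 0) := by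
    induction y with
    | zero => rfl
    | succ y ih =>
      rw [← ih (by omega)]
      by_contra hne
      refine hxL (Finset.mem_image.2 ⟨(x, y, true), ?_, rfl⟩)
      exact Finset.mem_filter.2 ⟨mem_gridEdges_true.2 ⟨hx, hy⟩, fun h => hne h.symm⟩
  rcases le_or_gt k D.card with hk | hk
  · refine ⟨0, (Finset.card_filter_le _ _).trans ?_⟩
    rw [gridBox, Finset.card_product, Finset.card_range, ← sq]
    gcongr
  · obtain ⟨x₀, hx₀, hx₀L⟩ := Finset.exists_mem_notMem_of_card_lt_card
      (s := L) (t := Finset.range k) (by rw [Finset.card_range]; omega)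
    obtain ⟨y₀, hy₀, hy₀R⟩ := Finset.exists_mem_notMem_of_card_lt_card
      (s := R) (t := Finset.range k) (by rw [Finset.card_range]; omega)
    rw [Finset.mem_range] at hx₀ hy₀
    refine ⟨g (x₀, y₀), ?_⟩
    have hsub : ((gridBox k).filter fun v => g v ≠ g (x₀, y₀)) ⊆ L ×ˢ R := by
      rintro ⟨x, y⟩ hv
      simp only [gridBox, Finset.mem_filter, Finset.mem_product, Finset.mem_range] at hv ⊢
      obtain ⟨⟨hx, hy⟩, hne⟩ := hv
      constructor
      · by_contra hxL
        exact hne (by rw [hcol x hx hxL y hy, ← hcol x hx hxL y₀ hy₀, hrow y₀ hy₀ hy₀R x hx,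
          ← hrow y₀ hy₀ hy₀R x₀ hx₀])
      · by_contra hyR
        exact hne (by rw [hrow y hy hyR x hx, ← hrow y hy hyR x₀ hx₀, hcol x₀ hx₀ hx₀L y hy,
          ← hcol x₀ hx₀ hx₀L y₀ hy₀])
    calc _ ≤ (L ×ˢ R).card := Finset.card_le_card hsub
      _ = L.card * R.card := Finset.card_product _ _
      _ ≤ D.card * D.card := Nat.mul_le_mul hL hR
      _ = _ := (sq _).symm

/-- A cluster meeting a unit square contains every cut edge of `f` on it, so the indicator of `S`
sums to zero around each square and has a potential, whose cut is `S`. Subtracting a constant makes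
its majority value zero. -/
theorem exists_potential_of_mem_clusters {k : ℕ} {f : ℕ × ℕ → ZMod 2} {S : Finset GridEdge}
    (hS : S ∈ clusters GridEdge.nearby (gridCut k f)) :
    ∃ g : ℕ × ℕ → ZMod 2,
      (∀ e ∈ gridEdges k, g e.target = g e.source + if e ∈ S then 1 else 0) ∧
      ((gridBox k).filter fun v => g v ≠ 0).card ≤ S.card ^ 2 := by
  have hdiff (a b : ZMod 2) : (if a ≠ b then 1 else 0 : ZMod 2) = a + b := by
    revert a b; decide
  obtain ⟨g, hg⟩ := exists_potential (k := k) (fun e => if e ∈ S then (1 : ZMod 2) else 0) (by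
    intro x y hx hy
    set s : Finset GridEdge :=
      {(x, y, false), (x + 1, y, true), (x, y + 1, false), (x, y, true)}
    have hs : ∀ e ∈ s, e ∈ gridEdges k := by
      simp only [s, Finset.mem_insert, Finset.mem_singleton, forall_eq_or_imp, forall_eq,
        mem_gridEdges_false, mem_gridEdges_true]
      omega
    have hnear : ∀ e ∈ s, ∀ e' ∈ s, e' ∈ e.nearby := by
      simp only [s, Finset.mem_insert, Finset.mem_singleton, forall_eq_or_imp, forall_eq,
        GridEdge.mem_nearby]
      omega
    by_cases hmeet : ∃ e ∈ s, e ∈ S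
    · obtain ⟨e, hes, heS⟩ := hmeet
      have hval : ∀ e' ∈ s, (if e' ∈ S then (1 : ZMod 2) else 0) =
          f e'.source + f e'.target := by
        intro e' he'
        rw [← hdiff]
        refine if_congr ⟨fun h => (Finset.mem_filter.1 (subset_of_mem_clusters hS h)).2,
          fun h => ?_⟩ rfl rfl
        exact mem_of_mem_clusters hS heS (Finset.mem_filter.2 ⟨hs e' he', h⟩)
          (hnear e hes e' he')
      have h2 : ∀ a : ZMod 2, a + a = 0 := CharTwo.add_self_eq_zero
      rw [hval (x, y, false) (by simp [s]), hval (x + 1, y, true) (by simp [s]),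
        hval (x, y + 1, false) (by simp [s]), hval (x, y, true) (by simp [s])]
      simp only [GridEdge.source, GridEdge.target]
      linear_combination h2 (f (x, y)) + h2 (f (x + 1, y)) + h2 (f (x + 1, y + 1)) +
        h2 (f (x, y + 1))
    · push Not at hmeet
      rw [if_neg (hmeet (x, y, false) (by simp [s])),
        if_neg (hmeet (x + 1, y, true) (by simp [s])),
        if_neg (hmeet (x, y + 1, false) (by simp [s])),
        if_neg (hmeet (x, y, true) (by simp [s]))]
      simp)
  have hcut : gridCut k g = S := by
    ext e
    rw [gridCut, Finset.mem_filter]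
    constructor
    · rintro ⟨he, hne⟩
      by_contra heS
      rw [hg e he, if_neg heS, add_zero] at hne
      exact hne rfl
    · intro heS
      have he : e ∈ gridEdges k := (Finset.mem_filter.1 (subset_of_mem_clusters hS heS)).1
      refine ⟨he, ?_⟩
      rw [hg e he, if_pos heS]
      simp
  obtain ⟨c, hc⟩ := card_ne_le_card_gridCut_sq (k := k) g
  rw [hcut] at hc
  refine ⟨fun v => g v - c, fun e he => ?_, ?_⟩
  · dsimp only
    rw [hg e he]; ring
  · simpa only [ne_eq, sub_eq_zero] using hc

theorem card_ne_le_sum_clusters_sq (k : ℕ) (f : ℕ × ℕ → ZMod 2) :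
    ∃ c, ((gridBox k).filter fun v => f v ≠ c).card ≤
      ∑ S ∈ clusters GridEdge.nearby (gridCut k f), S.card ^ 2 := by
  have hdiff (a b : ZMod 2) : (if a ≠ b then 1 else 0 : ZMod 2) = a + b := by
    revert a b; decide
  choose! G hG using fun S (hS : S ∈ clusters GridEdge.nearby (gridCut k f)) =>
    exists_potential_of_mem_clusters hS
  set K := clusters GridEdge.nearby (gridCut k f)
  have hind (e : GridEdge) : ∑ S ∈ K, (if e ∈ S then (1 : ZMod 2) else 0) =
      if e ∈ gridCut k f then 1 else 0 := by
    have h := sum_clusters GridEdge.nearby_symm (gridCut k f)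
      (fun e' => if e' = e then (1 : ZMod 2) else 0)
    simpa only [Finset.sum_ite_eq'] using h
  -- The clusters partition the cut of `f`, so adding all their potentials cancels it and `h` is
  -- constant on the grid. Where `f` differs from that constant, some `G S` is nonzero.
  set h : ℕ × ℕ → ZMod 2 := fun v => f v + ∑ S ∈ K, G S v
  have hcut : gridCut k h = ∅ := by
    rw [gridCut, Finset.filter_eq_empty_iff]
    intro e he
    have h2 : ∀ a : ZMod 2, a + a = 0 := CharTwo.add_self_eq_zero
    simp only [h, ne_eq, not_not]
    rw [Finset.sum_congr rfl fun S hS => (hG S hS).1 e he, Finset.sum_add_distrib, hind]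
    have h1 : (if e ∈ gridCut k f then (1 : ZMod 2) else 0) = f e.source + f e.target := by
      rw [← hdiff]
      exact if_congr (by rw [gridCut, Finset.mem_filter, and_iff_right he]) rfl rfl
    rw [h1]
    linear_combination -h2 (f e.target)
  obtain ⟨c, hc⟩ := card_ne_le_card_gridCut_sq (k := k) h
  rw [hcut, Finset.card_empty, zero_pow two_ne_zero, Nat.le_zero, Finset.card_eq_zero,
    Finset.filter_eq_empty_iff] at hc
  refine ⟨c, ?_⟩
  have hsub : ((gridBox k).filter fun v => f v ≠ c) ⊆
      K.biUnion fun S => (gridBox k).filter fun v => G S v ≠ 0 := by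
    intro v hv
    rw [Finset.mem_filter] at hv
    by_contra hcon
    simp only [Finset.mem_biUnion, Finset.mem_filter, not_exists, not_and, not_not] at hcon
    refine hv.2 ?_
    have hv' := not_not.1 (hc hv.1)
    simp only [h] at hv'
    rwa [Finset.sum_eq_zero fun S hS => hcon S hS hv.1, add_zero] at hv'
  exact (Finset.card_le_card hsub).trans (Finset.card_biUnion_le.trans
    (Finset.sum_le_sum fun S hS => (hG S hS).2))

end GridCuts

-- A vertex of `ξ` spoils at most `Δ` edges, since edges with a common endpoint lie in one `nb x`.
-- With `κ = 2 * Δ`, a set that is not bad therefore loses fewer than half its edges.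
open Classical in
theorem card_le_two_mul_card_open_of_not_isBadFor {V E : Type*} [DecidableEq V] [DecidableEq E]
    {ends : E → Finset V} {nb : E → Finset E} {Δ : ℕ} (hΔ : ∀ e, (nb e).card ≤ Δ)
    (hnb : ∀ v x y, v ∈ ends x → v ∈ ends y → y ∈ nb x) {ξ : Set V} {S : Finset E}
    (hS : ¬ IsBadFor ends (2 * Δ) ξ S) :
    S.card ≤ 2 * (S.filter fun e => ∀ v ∈ ends e, v ∉ ξ).card := by
  set W := (S.biUnion ends).filter (· ∈ ξ)
  have hW : ((↑(S.biUnion ends) ∩ ξ : Set V)).ncard = W.card := by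
    rw [← Set.ncard_coe_finset]; congr 1; ext v; simp [W]
  have hclosed : (S.filter fun e => ¬ ∀ v ∈ ends e, v ∉ ξ).card ≤ W.card * Δ := by
    have hsub : (S.filter fun e => ¬ ∀ v ∈ ends e, v ∉ ξ) ⊆
        W.biUnion fun v => S.filter fun e => v ∈ ends e := by
      intro e he
      rw [Finset.mem_filter] at he
      obtain ⟨heS, hv⟩ := he
      push Not at hv
      obtain ⟨v, hve, hvξ⟩ := hv
      exact Finset.mem_biUnion.2 ⟨v, Finset.mem_filter.2
        ⟨Finset.mem_biUnion.2 ⟨e, heS, hve⟩, hvξ⟩, Finset.mem_filter.2 ⟨heS, hve⟩⟩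
    refine (Finset.card_le_card hsub).trans (Finset.card_biUnion_le_card_mul _ _ _ fun v _ => ?_)
    rcases (S.filter fun e => v ∈ ends e).eq_empty_or_nonempty with h | ⟨x, hx⟩
    · simp [h]
    · exact (Finset.card_le_card fun y hy => hnb v x y (Finset.mem_filter.1 hx).2
        (Finset.mem_filter.1 hy).2).trans (hΔ x)
  have hgood : 2 * Δ * W.card < S.card := by
    rw [IsBadFor, hW, not_le] at hS
    exact_mod_cast hS
  have hsplit := Finset.card_filter_add_card_filter_not (s := S)
    (fun e => ∀ v ∈ ends e, v ∉ ξ)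
  have hcomm : 2 * Δ * W.card = 2 * (W.card * Δ) := by ring
  omega

/-! ### Application to colorings of the grid, and Chebyshev's inequality. -/

section Grid

/-- The endpoints of an edge that lie in the `k × k` grid. -/
def gridEnds (k : ℕ) (e : GridEdge) : Finset (GridVertex k) :=
  Finset.univ.filter fun v =>
    ((v.1 : ℕ), (v.2 : ℕ)) = e.source ∨ ((v.1 : ℕ), (v.2 : ℕ)) = e.target

theorem gridVertex_val_injective (k : ℕ) :
    Function.Injective fun v : GridVertex k => ((v.1 : ℕ), (v.2 : ℕ)) := by
  rintro ⟨a, b⟩ ⟨c, d⟩ h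
  simpa [Fin.ext_iff] using h

theorem card_gridEnds_le (k : ℕ) (e : GridEdge) : (gridEnds k e).card ≤ 2 := by
  refine (Finset.card_le_card_of_injOn (t := {e.source, e.target}) _ (fun v hv => ?_)
    (gridVertex_val_injective k).injOn).trans Finset.card_le_two
  simpa [gridEnds] using hv

theorem mem_nearby_of_mem_gridEnds {k : ℕ} (v : GridVertex k) (e f : GridEdge)
    (he : v ∈ gridEnds k e) (hf : v ∈ gridEnds k f) : f ∈ e.nearby := by
  obtain ⟨x, y, b⟩ := e
  obtain ⟨x', y', b'⟩ := f
  rw [gridEnds, Finset.mem_filter] at he hf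
  rw [GridEdge.mem_nearby]
  cases b <;> cases b' <;>
    simp only [GridEdge.source, GridEdge.target, Prod.mk.injEq] at he hf ⊢ <;> omega

/-- The code of a color: `0` for green, `1` for yellow. -/
def GYColor.code : GYColor → ZMod 2
  | green => 0
  | yellow => 1

/-- A coloring of the grid as a function on `ℕ × ℕ`. -/
def coloringCode {k : ℕ} (χ : GridVertex k → GYColor) (v : ℕ × ℕ) : ZMod 2 :=
  if h : v.1 < k ∧ v.2 < k then (χ (⟨v.1, h.1⟩, ⟨v.2, h.2⟩)).code else 0

open Classical in
theorem card_open_gridCut_le {k : ℕ} (ξ : Set (GridVertex k)) (χ : GridVertex k → GYColor) :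
    ((gridCut k (coloringCode χ)).filter fun e => ∀ v ∈ gridEnds k e, v ∉ ξ).card ≤
      greenYellowCount k ξ χ := by
  set P := {p : GridVertex k × GridVertex k | (gridGraph k).Adj p.1 p.2 ∧
    χ p.1 = GYColor.green ∧ χ p.2 = GYColor.yellow ∧ p.1 ∉ ξ ∧ p.2 ∉ ξ}
  -- `φ` recovers an edge from its endpoints in either order: the minima give the source, and equal
  -- first coordinates mean a vertical edge.
  set φ : GridVertex k × GridVertex k → GridEdge := fun p =>
    (min (p.1.1 : ℕ) p.2.1, min (p.1.2 : ℕ) p.2.2, decide (p.1.1 = p.2.1))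
  have hsub : (((gridCut k (coloringCode χ)).filter fun e => ∀ v ∈ gridEnds k e, v ∉ ξ :
      Finset GridEdge) : Set GridEdge) ⊆ φ '' P := by
    have key (u v : GridVertex k) (e : GridEdge) (hadj : (gridGraph k).Adj u v)
        (hχ : (χ u).code ≠ (χ v).code) (hu : u ∉ ξ) (hv : v ∉ ξ) (huv : φ (u, v) = e)
        (hvu : φ (v, u) = e) : e ∈ φ '' P := by
      cases hcu : χ u <;> cases hcv : χ v
      · simp [hcu, hcv] at hχ
      · exact ⟨(u, v), ⟨hadj, hcu, hcv, hu, hv⟩, huv⟩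
      · exact ⟨(v, u), ⟨hadj.symm, hcv, hcu, hv, hu⟩, hvu⟩
      · simp [hcu, hcv] at hχ
    rintro ⟨x, y, b⟩ he
    rw [Finset.mem_coe, Finset.mem_filter, gridCut, Finset.mem_filter] at he
    obtain ⟨⟨hmem, hne⟩, hopen⟩ := he
    cases b with
    | false =>
      rw [mem_gridEdges_false] at hmem
      have hx : x < k := by omega
      refine key (⟨x, hx⟩, ⟨y, hmem.2⟩) (⟨x + 1, hmem.1⟩, ⟨y, hmem.2⟩) _ ?_ ?_
        (hopen _ ?_) (hopen _ ?_) ?_ ?_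
      · simp [gridGraph, SimpleGraph.boxProd_adj, SimpleGraph.pathGraph_adj]
      · simpa [coloringCode, GridEdge.source, GridEdge.target, hmem, hx] using hne
      · simp [gridEnds, GridEdge.source]
      · simp [gridEnds, GridEdge.target]
      · simp [φ]
      · simp [φ]
    | true =>
      rw [mem_gridEdges_true] at hmem
      have hy : y < k := by omega
      refine key (⟨x, hmem.1⟩, ⟨y, hy⟩) (⟨x, hmem.1⟩, ⟨y + 1, hmem.2⟩) _ ?_ ?_
        (hopen _ ?_) (hopen _ ?_) ?_ ?_
      · simp [gridGraph, SimpleGraph.boxProd_adj, SimpleGraph.pathGraph_adj]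
      · simpa [coloringCode, GridEdge.source, GridEdge.target, hmem, hy] using hne
      · simp [gridEnds, GridEdge.source]
      · simp [gridEnds, GridEdge.target]
      · simp [φ]
      · simp [φ]
  rw [← Set.ncard_coe_finset]
  exact (Set.ncard_le_ncard hsub (Set.toFinite _)).trans (Set.ncard_image_le (Set.toFinite _))

theorem ncard_color_le {k : ℕ} (χ : GridVertex k → GYColor) (a : GYColor) (c : ZMod 2)
    (hac : a.code ≠ c) :
    {v | χ v = a}.ncard ≤ ((gridBox k).filter fun v => coloringCode χ v ≠ c).card := by
  rw [← Set.ncard_coe_finset]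
  refine Set.ncard_le_ncard_of_injOn (fun v : GridVertex k => ((v.1 : ℕ), (v.2 : ℕ)))
    (fun v hv => ?_) (gridVertex_val_injective k).injOn (Set.toFinite _)
  have hv' : χ v = a := hv
  rw [Finset.mem_coe, Finset.mem_filter]
  simp [gridBox, coloringCode, hv', hac]

open Classical in
/-- The nonempty sets of edges of the `k × k` grid that form a single cluster. -/
noncomputable def gridClusters (k : ℕ) : Finset (Finset GridEdge) :=
  (gridEdges k).powerset.filter fun S => S.Nonempty ∧ IsClusterFor GridEdge.nearby S

theorem mem_gridClusters {k : ℕ} {S : Finset GridEdge} : S ∈ gridClusters k ↔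
    S ⊆ gridEdges k ∧ S.Nonempty ∧ IsClusterFor GridEdge.nearby S := by
  classical
  rw [gridClusters, Finset.mem_filter, Finset.mem_powerset]

/-- Here `36 = 2 * 18`, where 18 bounds the size of `nearby`. Extending the bad sum to all of
`gridClusters k` removes the dependence on `χ`, so no union bound over colorings is needed. -/
theorem sum_clusters_sq_le {k : ℕ} (ξ : Set (GridVertex k)) (χ : GridVertex k → GYColor) :
    (∑ S ∈ clusters GridEdge.nearby (gridCut k (coloringCode χ)), (S.card : ℝ) ^ 2) ≤
      (2 * greenYellowCount k ξ χ : ℝ) ^ 2 +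
        ∑ S ∈ gridClusters k, badWeight (gridEnds k) 36 S ξ := by
  classical
  set D := gridCut k (coloringCode χ)
  set K := clusters GridEdge.nearby D
  set op : Finset GridEdge → Finset GridEdge := fun S =>
    S.filter fun e => ∀ v ∈ gridEnds k e, v ∉ ξ
  have hterm (S : Finset GridEdge) : (S.card : ℝ) ^ 2 ≤
      (2 * (op S).card : ℝ) ^ 2 + badWeight (gridEnds k) 36 S ξ := by
    by_cases hb : IsBadFor (gridEnds k) 36 ξ S
    · rw [badWeight, if_pos hb]
      have := sq_nonneg (2 * (op S).card : ℝ)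
      linarith
    · have h : S.card ≤ 2 * (op S).card := by
        convert card_le_two_mul_card_open_of_not_isBadFor (Δ := 18) GridEdge.card_nearby_le
          mem_nearby_of_mem_gridEnds hb
      have h' : (S.card : ℝ) ≤ 2 * (op S).card := by exact_mod_cast h
      have h0 := badWeight_nonneg (gridEnds k) 36 S ξ
      have : (S.card : ℝ) ^ 2 ≤ (2 * (op S).card : ℝ) ^ 2 := by gcongr
      linarith
  have hop : ∑ S ∈ K, (op S).card = (op D).card := by
    simp only [op, Finset.card_filter]
    exact sum_clusters GridEdge.nearby_symm D _
  have hopD : (op D).card ≤ greenYellowCount k ξ χ := card_open_gridCut_le ξ χ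
  calc _ ≤ ∑ S ∈ K, ((2 * (op S).card : ℝ) ^ 2 + badWeight (gridEnds k) 36 S ξ) :=
        Finset.sum_le_sum fun S _ => hterm S
    _ = ∑ S ∈ K, (2 * (op S).card : ℝ) ^ 2 + ∑ S ∈ K, badWeight (gridEnds k) 36 S ξ :=
        Finset.sum_add_distrib
    _ ≤ (∑ S ∈ K, (2 * (op S).card : ℝ)) ^ 2 +
        ∑ S ∈ gridClusters k, badWeight (gridEnds k) 36 S ξ := by
        refine add_le_add (Finset.sum_sq_le_sq_sum_of_nonneg fun S _ => by positivity)
          (Finset.sum_le_sum_of_subset_of_nonneg (fun S hS => mem_gridClusters.2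
            ⟨(subset_of_mem_clusters hS).trans (Finset.filter_subset _ _),
              nonempty_of_mem_clusters hS,
              isClusterFor_of_mem_clusters GridEdge.nearby_symm hS⟩)
            fun S _ _ => badWeight_nonneg _ _ _ _)
    _ ≤ _ := by
        rw [← Finset.mul_sum, ← Nat.cast_sum, hop]
        gcongr

theorem sq_div_four_le_of_isAdmissibleColoring {k : ℕ} (ξ : Set (GridVertex k))
    {χ : GridVertex k → GYColor} (hχ : IsAdmissibleColoring k χ) :
    (k : ℝ) ^ 2 / 4 ≤ (2 * greenYellowCount k ξ χ : ℝ) ^ 2 +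
      ∑ S ∈ gridClusters k, badWeight (gridEnds k) 36 S ξ := by
  obtain ⟨c, hc⟩ := card_ne_le_sum_clusters_sq k (coloringCode χ)
  obtain ⟨a, hac⟩ : ∃ a : GYColor, a.code ≠ c := by
    by_cases h : c = 0
    · exact ⟨.yellow, by simp [GYColor.code, h]⟩
    · exact ⟨.green, by simpa [GYColor.code] using Ne.symm h⟩
  have h1 : ({v | χ v = a}.ncard : ℝ) ≤
      ∑ S ∈ clusters GridEdge.nearby (gridCut k (coloringCode χ)), (S.card : ℝ) ^ 2 := by
    exact_mod_cast (ncard_color_le χ a c hac).trans hc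
  exact (hχ a).trans (h1.trans (sum_clusters_sq_le ξ χ))

/-- Ensures that the infimum in `minGreenYellow` is attained. -/
theorem exists_isAdmissibleColoring {k : ℕ} (hk : 2 ≤ k) :
    ∃ χ : GridVertex k → GYColor, IsAdmissibleColoring k χ := by
  classical
  have hcard (A : Finset (Fin k)) (m : ℕ) (hA : A.card = m) :
      ({v : GridVertex k | v.1 ∈ A}.ncard : ℝ) = m * k := by
    have : {v : GridVertex k | v.1 ∈ A} = ↑(A ×ˢ (Finset.univ : Finset (Fin k))) := by
      ext v; simp
    rw [this, Set.ncard_coe_finset, Finset.card_product, hA, Finset.card_univ, Fintype.card_fin]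
    push_cast; rfl
  obtain ⟨A, -, hA⟩ := Finset.exists_subset_card_eq (s := (Finset.univ : Finset (Fin k)))
    (n := k / 2) (by rw [Finset.card_univ, Fintype.card_fin]; omega)
  have hAc : Aᶜ.card = k - k / 2 := by rw [Finset.card_compl, Fintype.card_fin, hA]
  refine ⟨fun v => if v.1 ∈ A then .green else .yellow, fun a => ?_⟩
  have hbound (m : ℕ) (hm : k ≤ 4 * m) : (k : ℝ) ^ 2 / 4 ≤ m * k := by
    have hm' : (k : ℝ) ≤ 4 * m := by exact_mod_cast hm
    nlinarith [Nat.cast_nonneg (α := ℝ) k]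
  cases a with
  | green =>
    have : {v : GridVertex k | (if v.1 ∈ A then GYColor.green else .yellow) = .green} =
        {v | v.1 ∈ A} := by ext v; simp
    rw [this, hcard A _ hA]
    exact hbound _ (by omega)
  | yellow =>
    have : {v : GridVertex k | (if v.1 ∈ A then GYColor.green else .yellow) = .yellow} =
        {v | v.1 ∈ Aᶜ} := by ext v; simp
    rw [this, hcard Aᶜ _ hAc]
    exact hbound _ (by omega)

theorem sq_div_eight_le_of_minGreenYellow_lt {k : ℕ} (hk : 2 ≤ k) {ξ : Set (GridVertex k)}
    (hξ : (minGreenYellow k ξ : ℝ) < (k : ℝ) / 400) :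
    (k : ℝ) ^ 2 / 8 ≤ ∑ S ∈ gridClusters k, badWeight (gridEnds k) 36 S ξ := by
  obtain ⟨χ₀, hχ₀⟩ := exists_isAdmissibleColoring hk
  obtain ⟨χ, hχ, hmin⟩ := Nat.sInf_mem (s := {n | ∃ χ : GridVertex k → GYColor,
    IsAdmissibleColoring k χ ∧ greenYellowCount k ξ χ = n}) ⟨_, χ₀, hχ₀, rfl⟩
  have h := sq_div_four_le_of_isAdmissibleColoring ξ hχ
  rw [hmin] at h
  change (k : ℝ) ^ 2 / 4 ≤ (2 * minGreenYellow k ξ : ℝ) ^ 2 + _ at h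
  have h2 : (2 * minGreenYellow k ξ : ℝ) ^ 2 ≤ (2 * (k / 400)) ^ 2 := by gcongr
  nlinarith [sq_nonneg (k : ℝ)]

theorem setBernoulli_minGreenYellow_lt_le {k : ℕ} (hk : 2 ≤ k) {q : unitInterval}
    -- With `s = (1 / 2) ^ 14`, the convergence condition `18 ^ 2 * (16 * s) ≤ 1 / 2` holds; the
    -- mean and variance bounds then have ample room.
    (hq : (q : ℝ) = ((1 / 2) ^ 14) ^ (2 * 36)) :
    setBernoulli (Set.univ : Set (GridVertex k)) q
      {ξ | (minGreenYellow k ξ : ℝ) < (k : ℝ) / 400} ≤ ENNReal.ofReal (256 / (k : ℝ) ^ 2) := by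
  set μ := setBernoulli (Set.univ : Set (GridVertex k)) q
  set X : Set (GridVertex k) → ℝ := fun ξ =>
    ∑ S ∈ gridClusters k, badWeight (gridEnds k) 36 S ξ
  have hk0 : (0 : ℝ) < k := by exact_mod_cast (by omega : 0 < k)
  have hB : ((gridEdges k).card : ℝ) ≤ 2 * (k : ℝ) ^ 2 := by exact_mod_cast card_gridEdges_le k
  have hmean : μ[X] ≤ (k : ℝ) ^ 2 / 16 := by
    have := integral_sum_badWeight_le (C := gridClusters k) (card_gridEnds_le k)
      (by norm_num) (by norm_num) hq
      GridEdge.card_nearby_le GridEdge.nearby_symm (fun S hS => (mem_gridClusters.1 hS).2.2)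
      (fun S hS => (mem_gridClusters.1 hS).1) (fun S hS => (mem_gridClusters.1 hS).2.1)
      (by norm_num)
    refine this.trans ?_
    norm_num
    linarith [sq_nonneg (k : ℝ)]
  have hvar : Var[X; μ] ≤ (k : ℝ) ^ 2 := by
    have := variance_sum_badWeight_le (C := gridClusters k) (card_gridEnds_le k)
      (by norm_num) (by norm_num) hq
      GridEdge.card_nearby_le GridEdge.nearby_symm mem_nearby_of_mem_gridEnds
      (fun S hS => (mem_gridClusters.1 hS).2.2)
      (fun S hS => (mem_gridClusters.1 hS).1) (fun S hS => (mem_gridClusters.1 hS).2.1)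
      (by norm_num)
    refine this.trans ?_
    norm_num
    linarith [sq_nonneg (k : ℝ)]
  calc _ ≤ μ {ξ | (k : ℝ) ^ 2 / 16 ≤ |X ξ - μ[X]|} := by
        refine measure_mono fun ξ hξ => ?_
        have h := sq_div_eight_le_of_minGreenYellow_lt hk hξ
        have h' : (k : ℝ) ^ 2 / 8 ≤ X ξ := h
        exact (by linarith : (k : ℝ) ^ 2 / 16 ≤ X ξ - μ[X]).trans (le_abs_self _)
    _ ≤ ENNReal.ofReal (Var[X; μ] / ((k : ℝ) ^ 2 / 16) ^ 2) :=
        meas_ge_le_variance_div_sq memLp_setBernoulli (by positivity)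
    _ ≤ ENNReal.ofReal (256 / (k : ℝ) ^ 2) := by
        refine ENNReal.ofReal_le_ofReal ?_
        rw [div_le_div_iff₀ (by positivity) (by positivity)]
        nlinarith [mul_le_mul_of_nonneg_right hvar (sq_nonneg (k : ℝ))]

end Grid

theorem lemma2 :
    ∃ q : unitInterval, 0 < q ∧
      Tendsto
        (fun k : ℕ => setBernoulli (Set.univ : Set (GridVertex k)) q
          {ξ | (minGreenYellow k ξ : ℝ) < (k : ℝ) / 400})
        atTop (𝓝 0) := by
  have hmem : (((1 : ℝ) / 2) ^ 14) ^ (2 * 36) ∈ unitInterval :=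
    ⟨by positivity, pow_le_one₀ (by positivity) (pow_le_one₀ (by norm_num) (by norm_num))⟩
  refine ⟨⟨_, hmem⟩, Subtype.mk_lt_mk.2 (by positivity), ?_⟩
  have hlim : Tendsto (fun k : ℕ => ENNReal.ofReal (256 / (k : ℝ) ^ 2)) atTop (𝓝 0) := by
    rw [← ENNReal.ofReal_zero]
    exact ENNReal.tendsto_ofReal (tendsto_const_nhds.div_atTop
      ((tendsto_pow_atTop two_ne_zero).comp tendsto_natCast_atTop_atTop))
  refine tendsto_of_tendsto_of_tendsto_of_le_of_le' tendsto_const_nhds hlim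
    (Eventually.of_forall fun _ => zero_le) ?_
  -- For `k = 1` no coloring is admissible and the infimum takes the default value 0.
  filter_upwards [eventually_ge_atTop 2] with k hk
  exact setBernoulli_minGreenYellow_lt_le hk rfl
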